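/- Let $A_1,\dots,A_m,B$ be real symmetric $n\times n$ matrices such that the semidefinite program $$(P)\qquad x_1A_1+\dots+x_mA_m+B\succeq 0$$ is strictly feasible, i.e. $\sum_i x_iA_i+B\succ 0$ for some $x\in\mathbb R^m$. A *reformulation* of $(P)$ is a program obtained from it by finitely many of the following operations: exchange $A_i$ and $A_j$; replace $A_i$ by $\lambda A_i+\mu A_j$ with $\lambda\neq 0$ and $j\ne i$ (or by $\lambda A_i$, $\lambda\ne0$); replace all $A_i$ by $T^\top A_iT$ and $B$ by $T^\top BT$ with $T$ invertible. A sequence $(C_1,\dots,C_k)$ of symmetric $n\times n$ matrices is a *regular facial reduction sequence* with block sizes $r_1,\dots,r_k\ge 0$, $r_1+\dots+r_k\le n$, if for each $i$ deleting the first $r_1+\dots+r_{i-1}$ rows and columns of $C_i$ leaves $\begin{pmatrix} I_{r_i}&0\\0&0\end{pmatrix}$. Call an integer $k$ with $0\le k\le m$ *admissible* if $(P)$ has a reformulation $$(P')\qquad x_1A_1'+\dots+x_mA_m'+B'\succeq 0$$ such that $(A_1',\dots,A_k')$ is a regular facial reduction sequence, with block sizes $r_1,\dots,r_k$ for which $n-r_1-\dots-r_k$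 is the maximum rank of a matrix in $\{Y\succeq 0 : \operatorname{trace}(A_iY)=0,\ i=1,\dots,m\}$. Let $k$ be the smallest admissible integer, let $(P')$ be a reformulation as above with this $k$, and fix a partially strictly feasible $(\bar x_{k+1},\dots,\bar x_m)$, i.e. one for which some $(x_1,\dots,x_k)$ makes $(x_1,\dots,x_k,\bar x_{k+1},\dots,\bar x_m)$ strictly feasible in $(P')$. Then: 1. If $k\ge 1$, for every $M\in\mathbb R$ there is $(x_1,\dots,x_k)$ with $x_k\ge M$ such that $(x_1,\dots,x_k,\bar x_{k+1},\dots,\bar x_m)$ is strictly feasible in $(P')$. 2. There are constants $d_2,\dots,d_k>0$ and $\alpha_2,\dots,\alpha_k$ with $$2\ \ge\ \alpha_{j+1}\ \ge\ 1+\frac1{k-j}\qquad (j=1,\dots,k-1)$$ and a constant $K$, all depending only on the programs $(P)$, $(P')$ and on $\bar x_{k+1},\dots,\bar x_m$, such that whenever $(x_1,\dots,x_k,\bar x_{k+1},\dots,\bar x_m)$ is strictly feasible in $(P')$ and $x_k\ge K$, the numbers $x_1,\dots,x_k$ are positive and $$x_j\ \ge\ d_{j+1}\,x_{j+1}^{\alpha_{j+1}}\qquad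 (j=1,\dots,k-1).$$ -/

import Mathlib

open Matrix

/-- The matrix `∑ i, x i • A i + B` that a semidefinite program constrains to be psd. -/
def slack {m n : ℕ} (A : Fin m → Matrix (Fin n) (Fin n) ℝ) (B : Matrix (Fin n) (Fin n) ℝ)
    (x : Fin m → ℝ) : Matrix (Fin n) (Fin n) ℝ :=
  (∑ i, x i • A i) + B

/-- `x` is strictly feasible: `∑ i, x i • A i + B` is positive definite. -/
def StrictlyFeasible {m n : ℕ} (A : Fin m → Matrix (Fin n) (Fin n) ℝ)
    (B : Matrix (Fin n) (Fin n) ℝ) (x : Fin m → ℝ) : Prop :=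
  (slack A B x).PosDef

/-- `(C_1, …, C_k)` is a regular facial reduction sequence with identity blocks of sizes
`r_1, …, r_k`: each `C_i` is symmetric, and outside its first `r_1 + ⋯ + r_{i-1}` rows and columns
(which are arbitrary) it is the block diagonal matrix `diag(I_{r_i}, 0)`. -/
def IsRegularFRSeq {n k : ℕ} (r : Fin k → ℕ) (C : Fin k → Matrix (Fin n) (Fin n) ℝ) : Prop :=
  ∑ i, r i ≤ n ∧
  ∀ i, (C i).IsSymm ∧
    ∀ p q : Fin n, ∑ l ∈ Finset.Iio i, r l ≤ (p : ℕ) → ∑ l ∈ Finset.Iio i, r l ≤ (q : ℕ) →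
      C i p q = if p = q ∧ (p : ℕ) < (∑ l ∈ Finset.Iio i, r l) + r i then 1 else 0

/-- One elementary reformulation operation on the data `(A, B)` of a semidefinite program. -/
inductive ReformStep {m n : ℕ} :
    (Fin m → Matrix (Fin n) (Fin n) ℝ) × Matrix (Fin n) (Fin n) ℝ →
    (Fin m → Matrix (Fin n) (Fin n) ℝ) × Matrix (Fin n) (Fin n) ℝ → Prop
  /-- Exchange `A i` and `A j`. -/
  | exchange (A : Fin m → Matrix (Fin n) (Fin n) ℝ) (B : Matrix (Fin n) (Fin n) ℝ)
      (i j : Fin m) (hij : i ≠ j) :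
      ReformStep (A, B) (A ∘ Equiv.swap i j, B)
  /-- Replace `A i` by `a • A i + b • A j` with `a ≠ 0`. The case `b = 0`, the scaling of `A i`,
  needs no second index. -/
  | combine (A : Fin m → Matrix (Fin n) (Fin n) ℝ) (B : Matrix (Fin n) (Fin n) ℝ)
      (i j : Fin m) (a b : ℝ) (ha : a ≠ 0) (hij : i ≠ j ∨ b = 0) :
      ReformStep (A, B) (Function.update A i (a • A i + b • A j), B)
  /-- Congruence by an invertible matrix `T`, applied to all the matrices of the program. -/
  | rotate (A : Fin m → Matrix (Fin n) (Fin n) ℝ) (B : Matrix (Fin n) (Fin n) ℝ)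
      (T : Matrix (Fin n) (Fin n) ℝ) (hT : IsUnit T) :
      ReformStep (A, B) (fun i => Tᵀ * A i * T, Tᵀ * B * T)

/-- `(A', B')` is a reformulation of `(A, B)`: it arises by finitely many elementary operations. -/
def IsReformulation {m n : ℕ} (A : Fin m → Matrix (Fin n) (Fin n) ℝ)
    (B : Matrix (Fin n) (Fin n) ℝ) (A' : Fin m → Matrix (Fin n) (Fin n) ℝ)
    (B' : Matrix (Fin n) (Fin n) ℝ) : Prop :=
  Relation.ReflTransGen ReformStep (A, B) (A', B')

/-- The ranks of the psd matrices `Y` with `trace (A i * Y) = 0` for all `i`. -/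
def dualRanks {m n : ℕ} (A : Fin m → Matrix (Fin n) (Fin n) ℝ) : Set ℕ :=
  {ρ | ∃ Y : Matrix (Fin n) (Fin n) ℝ, Y.PosSemidef ∧ (∀ i, (A i * Y).trace = 0) ∧ Y.rank = ρ}

/-- `(A', B')` is a reformulation of `(A, B)` whose first `k` matrices form a regular facial
reduction sequence, with identity blocks of sizes `r_1, …, r_k` such that `n - r_1 - ⋯ - r_k` is
the maximum rank of a psd matrix `Y` with `trace (A i * Y) = 0` for all `i`. -/
def IsRegularizedForm {m n : ℕ} (A : Fin m → Matrix (Fin n) (Fin n) ℝ)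
    (B : Matrix (Fin n) (Fin n) ℝ) (k : ℕ) (A' : Fin m → Matrix (Fin n) (Fin n) ℝ)
    (B' : Matrix (Fin n) (Fin n) ℝ) : Prop :=
  IsReformulation A B A' B' ∧
  ∃ (hk : k ≤ m) (r : Fin k → ℕ),
    IsRegularFRSeq r (fun i => A' (Fin.castLE hk i)) ∧
    IsGreatest (dualRanks A) (n - ∑ i, r i)

/-- `x` completes the tail `(x̄_{k+1}, …, x̄_m)`. Indices in `Fin m` start at `0`, so the tail is
indexed by the `i : Fin m` with `k ≤ i`. -/
def Completes {m k : ℕ} (xbar : {i : Fin m // k ≤ (i : ℕ)} → ℝ) (x : Fin m → ℝ) : Prop :=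
  ∀ i : {i : Fin m // k ≤ (i : ℕ)}, x i = xbar i

/-- The tail `(x̄_{k+1}, …, x̄_m)` has a strictly feasible completion. -/
def PartiallyStrictlyFeasible {m n k : ℕ} (A : Fin m → Matrix (Fin n) (Fin n) ℝ)
    (B : Matrix (Fin n) (Fin n) ℝ) (xbar : {i : Fin m // k ≤ (i : ℕ)} → ℝ) : Prop :=
  ∃ x : Fin m → ℝ, Completes xbar x ∧ StrictlyFeasible A B x

/-! Write S for the slack matrix.

Large feasible points: on vectors supported from the i-th block onwards, A_i is the form diag(I, 0),
hence positive semidefinite, and it vanishes exactly on vectors supported after that block. So x_k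
may be raised freely at the cost of positivity on the earlier blocks only. That positivity is
restored by enlarging x_{k-1}, ..., x_1 in this order, each step by compactness of the unit sphere
(`exists_add_smul_pos_on_support`).

Growth: minimality of k forces A_{j+1} to have a nonzero entry (p, q) with p in block j and q after
block j+1. Otherwise A_{j+1} + c A_j, with c large, is positive definite on the union of both blocks
and zero outside it, so a congruence merges the two blocks and k - 1 is admissible
(`IsOffsetFRSeq.exists_merge`). At such a position, as x_k tends to infinity, S_pp = x_j +
O(x_{j+1}), S_qq = O(x_{j+2}), and S_pq is of exact order x_{j+1}. The 2 × 2 minor then gives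
x_{j+1}^2 ≤ C x_{j+2} (x_j + C x_{j+1}).

If x_{j+2} ≤ D x_{j+1}^β with β < 1, this yields x_{j+1}^(2-β) ≤ E x_j, and hence x_{j+1} ≤ D'
x_j^(1/(2-β)). Starting from β = 0 (with 1 in place of x_{k+1}), the recursion α = 2 - β, β' = 1/α
produces α_{j+1} = 1 + 1/(k - j). -/

/-- The first `k` matrices of `A` form a regular facial reduction sequence whose `i`-th identity
block occupies the indices `s i ≤ p < s (i + 1)`. -/
def IsOffsetFRSeq {m n : ℕ} (k : ℕ) (s : ℕ → ℕ) (A : Fin m → Matrix (Fin n) (Fin n) ℝ) : Prop :=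
  Monotone s ∧ s 0 = 0 ∧
  ∀ i : Fin m, (i : ℕ) < k → (A i).IsSymm ∧
    ∀ p q : Fin n, s i ≤ (p : ℕ) → s i ≤ (q : ℕ) →
      A i p q = if p = q ∧ (p : ℕ) < s (i + 1) then 1 else 0

/-! ### Block sizes and their cumulative offsets. -/

theorem Fin.sum_filter_lt_succ {k : ℕ} (r : Fin k → ℕ) (i : Fin k) :
    ∑ l ∈ Finset.univ.filter (fun l : Fin k => (l : ℕ) < i + 1), r l = (∑ l ∈ Finset.univ.filter (fun l : Fin k => (l : ℕ) < i), r l) + r i := by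
  have h : (Finset.univ.filter fun l : Fin k => (l : ℕ) < i + 1) =
      insert i (Finset.univ.filter fun l : Fin k => (l : ℕ) < i) := by
    ext l
    simp [Fin.ext_iff]
    omega
  rw [h, Finset.sum_insert (by simp), add_comm]

theorem Fin.sum_filter_lt_eq_sum_Iio {k : ℕ} (r : Fin k → ℕ) (i : Fin k) :
    ∑ l ∈ Finset.univ.filter (fun l : Fin k => (l : ℕ) < i), r l = ∑ l ∈ Finset.Iio i, r l := by
  congr 1
  ext l
  simp

theorem Fin.sum_filter_lt_self {k : ℕ} (r : Fin k → ℕ) :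
    ∑ l ∈ Finset.univ.filter (fun l : Fin k => (l : ℕ) < k), r l = ∑ l, r l := by
  simp

/-- The offsets are the partial sums of the block sizes. Indexing them by `ℕ` gives the end `s (i +
1)` of a block a meaning for the last block too. -/
theorem IsRegularFRSeq.exists_offsets {m n k : ℕ} {hk : k ≤ m} {r : Fin k → ℕ}
    {A : Fin m → Matrix (Fin n) (Fin n) ℝ}
    (h : IsRegularFRSeq r (fun i => A (Fin.castLE hk i))) :
    ∃ s : ℕ → ℕ, IsOffsetFRSeq k s A ∧ s k = ∑ i, r i := by
  refine ⟨fun i => ∑ l ∈ Finset.univ.filter (fun l : Fin k => (l : ℕ) < i), r l, ⟨?_, by simp, ?_⟩,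
    Fin.sum_filter_lt_self r⟩
  · intro a b hab
    refine Finset.sum_le_sum_of_subset fun l hl => ?_
    simp only [Finset.mem_filter, Finset.mem_univ, true_and] at hl ⊢
    omega
  · intro i hi
    obtain ⟨h1, h2⟩ := h.2 ⟨i, hi⟩
    refine ⟨h1, fun p q hp hq => ?_⟩
    have e1 := Fin.sum_filter_lt_eq_sum_Iio r ⟨i, hi⟩
    have e2 := Fin.sum_filter_lt_succ r ⟨i, hi⟩
    simp only at e1 e2 hp hq
    have h3 := h2 p q (by rwa [← e1]) (by rwa [← e1])
    simp only [← e1, ← e2] at h3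
    exact h3

theorem Fin.sum_filter_lt_sub {k : ℕ} {s : ℕ → ℕ} (hs : Monotone s) (h0 : s 0 = 0) :
    ∀ i ≤ k, ∑ l ∈ Finset.univ.filter (fun l : Fin k => (l : ℕ) < i), (s (l + 1) - s l) = s i := by
  intro i
  induction i with
  | zero => simp [h0]
  | succ i ih =>
    intro hi
    have := Fin.sum_filter_lt_succ (fun l : Fin k => s (l + 1) - s l) ⟨i, hi⟩
    simp only at this
    rw [this, ih (by omega)]
    have := hs (Nat.le_succ i)
    simp only [Nat.succ_eq_add_one] at this
    omega

theorem IsOffsetFRSeq.isRegularFRSeq {m n k : ℕ} {s : ℕ → ℕ}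
    {A : Fin m → Matrix (Fin n) (Fin n) ℝ} (h : IsOffsetFRSeq k s A) (hk : k ≤ m)
    (hn : s k ≤ n) :
    ∃ r : Fin k → ℕ, IsRegularFRSeq r (fun i => A (Fin.castLE hk i)) ∧ ∑ i, r i = s k := by
  obtain ⟨hs, h0, h⟩ := h
  have hsum := Fin.sum_filter_lt_sub (k := k) hs h0
  have htot : ∑ l : Fin k, (s (l + 1) - s l) = s k := by
    rw [← hsum k le_rfl, Fin.sum_filter_lt_self]
  refine ⟨fun l => s (l + 1) - s l, ⟨htot.trans_le hn, fun i => ?_⟩, htot⟩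
  obtain ⟨h1, h2⟩ := h (Fin.castLE hk i) i.2
  refine ⟨h1, ?_⟩
  have e1 := Fin.sum_filter_lt_eq_sum_Iio (fun l : Fin k => s (l + 1) - s l) i
  rw [hsum i i.2.le] at e1
  rw [← e1]
  intro p q hp hq
  have := h2 p q hp hq
  have h3 := hs (Nat.le_succ i)
  simp only [Nat.succ_eq_add_one] at h3
  rw [Nat.add_sub_cancel' h3]
  exact this

/-! ### Quadratic forms restricted to coordinate subspaces. -/

section QuadraticForm

variable {n : ℕ}

theorem quadForm_add_smul (S C : Matrix (Fin n) (Fin n) ℝ) (t : ℝ) (v : Fin n → ℝ) :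
    v ⬝ᵥ ((S + t • C) *ᵥ v) = v ⬝ᵥ (S *ᵥ v) + t * (v ⬝ᵥ (C *ᵥ v)) := by
  simp [add_mulVec, smul_mulVec, dotProduct_add, dotProduct_smul]

/-- If `C` is positive semidefinite on the vectors supported in `U`, and `S` is positive definite
on those among them where `C` vanishes, then `S + t C` is positive definite on all of them for
some `t`. -/
theorem exists_add_smul_pos_on_support (U : Set (Fin n)) (S C : Matrix (Fin n) (Fin n) ℝ)
    (hC : ∀ v : Fin n → ℝ, (∀ a ∉ U, v a = 0) → 0 ≤ v ⬝ᵥ (C *ᵥ v))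
    (hS : ∀ v : Fin n → ℝ, (∀ a ∉ U, v a = 0) → v ≠ 0 → v ⬝ᵥ (C *ᵥ v) = 0 →
      0 < v ⬝ᵥ (S *ᵥ v)) :
    ∃ t : ℝ, ∀ v : Fin n → ℝ, (∀ a ∉ U, v a = 0) → v ≠ 0 → 0 < v ⬝ᵥ ((S + t • C) *ᵥ v) := by
  have hcont : ∀ M : Matrix (Fin n) (Fin n) ℝ, Continuous fun v : Fin n → ℝ => v ⬝ᵥ (M *ᵥ v) :=
    fun M => by simp only [dotProduct, mulVec]; fun_prop
  have hW : IsClosed {v : Fin n → ℝ | ∀ a ∉ U, v a = 0} := by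
    simp only [Set.ofPred_forall]
    exact isClosed_iInter fun a => isClosed_iInter fun _ =>
      isClosed_eq (continuous_apply a) continuous_const
  set K : Set (Fin n → ℝ) := Metric.sphere 0 1 ∩ {v | ∀ a ∉ U, v a = 0} with hK
  have hKc : IsCompact K := (isCompact_sphere _ _).inter_right hW
  have hne : ∀ v ∈ K, v ≠ 0 := by
    rintro v ⟨hv, -⟩ rfl
    simp at hv
  suffices h : ∃ t : ℝ, ∀ v ∈ K, 0 < v ⬝ᵥ ((S + t • C) *ᵥ v) by
    obtain ⟨t, ht⟩ := h
    refine ⟨t, fun v hv hv0 => ?_⟩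
    have hnv : 0 < ‖v‖ := norm_pos_iff.2 hv0
    have := ht (‖v‖⁻¹ • v) ⟨by simp [norm_smul, hnv.ne'], fun a ha => by simp [hv a ha]⟩
    rw [mulVec_smul, smul_dotProduct, dotProduct_smul, smul_smul, smul_eq_mul] at this
    exact pos_of_mul_pos_right this (by positivity)
  obtain ⟨N, hN⟩ : ∃ N : ℝ, ∀ v ∈ K, -N ≤ v ⬝ᵥ (S *ᵥ v) := by
    obtain ⟨b, hb⟩ := (hKc.image (hcont S)).bddBelow
    exact ⟨-b, fun v hv => by simpa using hb (Set.mem_image_of_mem _ hv)⟩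
  -- Only unit vectors where `S` fails to be positive need help. They form a compact set on which
  -- the form of `C` is strictly positive, hence at least some `ε > 0`; since `-N` bounds `S` below,
  -- `t = (|N| + 1) / ε` suffices.
  set K' := K ∩ {v | v ⬝ᵥ (S *ᵥ v) ≤ 0}
  have hKc' : IsCompact K' := hKc.inter_right (isClosed_le (hcont S) continuous_const)
  obtain ⟨ε, hε, hεK⟩ : ∃ ε > 0, ∀ v ∈ K', ε ≤ v ⬝ᵥ (C *ᵥ v) := by
    rcases K'.eq_empty_or_nonempty with h | h
    · exact ⟨1, one_pos, by simp [h]⟩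
    · obtain ⟨w, hw, hmin⟩ := hKc'.exists_isMinOn h (hcont C).continuousOn
      refine ⟨w ⬝ᵥ (C *ᵥ w), lt_of_le_of_ne (hC w hw.1.2) fun h0 => ?_, fun v hv => hmin hv⟩
      exact absurd (hS w hw.1.2 (hne w hw.1) h0.symm) (not_lt.2 hw.2)
  refine ⟨(|N| + 1) / ε, fun v hv => ?_⟩
  rw [quadForm_add_smul]
  have hCv := hC v hv.2
  have ht : 0 < (|N| + 1) / ε := by positivity
  by_cases hv0 : v ⬝ᵥ (S *ᵥ v) ≤ 0
  · have h1 : (|N| + 1) / ε * ε ≤ (|N| + 1) / ε * (v ⬝ᵥ (C *ᵥ v)) :=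
      mul_le_mul_of_nonneg_left (hεK v ⟨hv, hv0⟩) ht.le
    rw [div_mul_cancel₀ _ hε.ne'] at h1
    linarith [hN v hv, le_abs_self N]
  · have : 0 ≤ (|N| + 1) / ε * (v ⬝ᵥ (C *ᵥ v)) := by positivity
    linarith

/-- The form of a matrix that is `diag(I, 0)` on the indices in `U`. -/
theorem quadForm_eq_sum_sq {U : Set (Fin n)} {C : Matrix (Fin n) (Fin n) ℝ} {P : Fin n → Prop}
    [DecidablePred P] (hC : ∀ p ∈ U, ∀ q ∈ U, C p q = if p = q ∧ P p then 1 else 0)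
    {v : Fin n → ℝ} (hv : ∀ a ∉ U, v a = 0) :
    v ⬝ᵥ (C *ᵥ v) = ∑ a, if P a then v a ^ 2 else 0 := by
  simp only [dotProduct, mulVec]
  refine Finset.sum_congr rfl fun a _ => ?_
  by_cases ha : a ∈ U
  · have : ∀ b, C a b * v b = if a = b then (if P a then v a else 0) else 0 := by
      intro b
      by_cases hb : b ∈ U
      · rw [hC a ha b hb]
        by_cases hab : a = b
        · subst hab
          by_cases hp : P a <;> simp [hp]
        · simp [hab]
      · have hab : a ≠ b := fun h => hb (h ▸ ha)
        simp [hv b hb, hab]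
    rw [Finset.sum_congr rfl fun b _ => this b, Finset.sum_ite_eq]
    by_cases hp : P a <;> simp [hp, sq]
  · simp [hv a ha]

theorem quadForm_nonneg_of_block {U : Set (Fin n)} {C : Matrix (Fin n) (Fin n) ℝ}
    {P : Fin n → Prop} [DecidablePred P]
    (hC : ∀ p ∈ U, ∀ q ∈ U, C p q = if p = q ∧ P p then 1 else 0)
    {v : Fin n → ℝ} (hv : ∀ a ∉ U, v a = 0) : 0 ≤ v ⬝ᵥ (C *ᵥ v) := by
  rw [quadForm_eq_sum_sq hC hv]
  exact Finset.sum_nonneg fun a _ => by split_ifs <;> positivity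

theorem eq_zero_of_quadForm_block_eq_zero {U : Set (Fin n)} {C : Matrix (Fin n) (Fin n) ℝ}
    {P : Fin n → Prop} [DecidablePred P]
    (hC : ∀ p ∈ U, ∀ q ∈ U, C p q = if p = q ∧ P p then 1 else 0)
    {v : Fin n → ℝ} (hv : ∀ a ∉ U, v a = 0) (h : v ⬝ᵥ (C *ᵥ v) = 0) {a : Fin n} (ha : P a) :
    v a = 0 := by
  rw [quadForm_eq_sum_sq hC hv, Finset.sum_eq_zero_iff_of_nonneg
    (fun a _ => by split_ifs <;> positivity)] at h
  simpa [ha] using h a (Finset.mem_univ a)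

end QuadraticForm

/-! ### Strictly feasible points with the last reducing variable large. -/

section LargeFeasiblePoints

variable {m n : ℕ}

theorem slack_update (A : Fin m → Matrix (Fin n) (Fin n) ℝ) (B : Matrix (Fin n) (Fin n) ℝ)
    (x : Fin m → ℝ) (i : Fin m) (y : ℝ) :
    slack A B (Function.update x i y) = slack A B x + (y - x i) • A i := by
  have h : ∀ l, Function.update x i y l • A l =
      x l • A l + if l = i then (y - x i) • A i else 0 := by
    intro l
    by_cases hl : l = i
    · subst hl
      simp [sub_smul]
    · simp [hl]
  simp only [slack]
  rw [Finset.sum_congr rfl fun l _ => h l, Finset.sum_add_distrib, Finset.sum_ite_eq']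
  simp only [Finset.mem_univ, if_true]
  abel

/-- Strict feasibility can be restored after making the last reducing variable large, by enlarging
the previous ones one after the other. -/
theorem exists_strictlyFeasible_large {k : ℕ} {s : ℕ → ℕ}
    {A : Fin m → Matrix (Fin n) (Fin n) ℝ} {B : Matrix (Fin n) (Fin n) ℝ}
    (hA : IsOffsetFRSeq k s A) (hk : k ≤ m)
    {xbar : {i : Fin m // k ≤ (i : ℕ)} → ℝ} (hx : PartiallyStrictlyFeasible A B xbar) (M : ℝ) :
    ∃ x : Fin m → ℝ, Completes xbar x ∧ StrictlyFeasible A B x ∧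
      ∀ i : Fin m, (i : ℕ) + 1 = k → M ≤ x i := by
  obtain ⟨hs, h0, hA⟩ := hA
  obtain ⟨x₀, hx₀, hpd⟩ := hx
  rcases Nat.eq_zero_or_pos k with rfl | hkpos
  · exact ⟨x₀, hx₀, hpd, fun i hi => by omega⟩
  have hpd' := posDef_iff_dotProduct_mulVec.1 hpd
  -- Descending induction over the blocks: stage `t` has adjusted the last `t + 1` reducing
  -- variables and guarantees positivity only on vectors supported from the block of the last one
  -- adjusted. At `t = k - 1` this is the whole space.
  have key : ∀ t, t + 1 ≤ k → ∃ x : Fin m → ℝ, Completes xbar x ∧ (slack A B x).IsSymm ∧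
      (∀ i : Fin m, (i : ℕ) + 1 = k → M ≤ x i) ∧
      ∀ v : Fin n → ℝ, (∀ a ∉ {a : Fin n | s (k - (t + 1)) ≤ a}, v a = 0) → v ≠ 0 →
        0 < v ⬝ᵥ (slack A B x *ᵥ v) := by
    intro t
    induction t with
    | zero =>
      intro _
      let i : Fin m := ⟨k - 1, by omega⟩
      have hi : (i : ℕ) < k := by simp [i]; omega
      obtain ⟨hsym, hblock⟩ := hA i hi
      -- The maximum makes the increment nonnegative, so a positive semidefinite form is added.
      refine ⟨Function.update x₀ i (max M (x₀ i)), fun l => ?_, ?_, fun l hl => ?_, ?_⟩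
      · rw [Function.update_of_ne, hx₀ l]
        intro h
        have := l.2
        rw [h] at this
        omega
      · rw [slack_update]
        exact IsSymm.add (by simpa [IsHermitian, IsSymm] using hpd'.1) (hsym.smul _)
      · have : l = i := Fin.ext (by simp [i]; omega)
        subst this
        simp
      · intro v hv hv0
        rw [slack_update, quadForm_add_smul]
        have h1 : 0 < v ⬝ᵥ (slack A B x₀ *ᵥ v) := by simpa using hpd'.2 hv0
        have h2 : 0 ≤ v ⬝ᵥ (A i *ᵥ v) :=
          quadForm_nonneg_of_block (P := fun p => (p : ℕ) < s (i + 1))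
            (fun p hp q hq => hblock p q hp hq) hv
        have h3 : 0 ≤ max M (x₀ i) - x₀ i := sub_nonneg.2 (le_max_right _ _)
        positivity
    | succ t ih =>
      intro ht
      obtain ⟨x, hxc, hxs, hxM, hxp⟩ := ih (by omega)
      let i : Fin m := ⟨k - (t + 1 + 1), by omega⟩
      have hi : (i : ℕ) < k := by simp [i]; omega
      have hi1 : (i : ℕ) + 1 = k - (t + 1) := by simp [i]; omega
      obtain ⟨hsym, hblock⟩ := hA i hi
      have hb : ∀ p ∈ {a : Fin n | s (k - (t + 1 + 1)) ≤ a},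
          ∀ q ∈ {a : Fin n | s (k - (t + 1 + 1)) ≤ a},
          A i p q = if p = q ∧ (p : ℕ) < s (i + 1) then 1 else 0 :=
        fun p hp q hq => hblock p q hp hq
      -- Where the form of `A i` vanishes, the vector is supported after block `i`, and positivity
      -- there is the induction hypothesis.
      obtain ⟨y, hy⟩ := exists_add_smul_pos_on_support {a : Fin n | s (k - (t + 1 + 1)) ≤ a}
        (slack A B x) (A i)
        (fun v hv => quadForm_nonneg_of_block (P := fun p => (p : ℕ) < s (i + 1)) hb hv)
        (fun v hv hv0 hz => hxp v (fun a ha => by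
          refine eq_zero_of_quadForm_block_eq_zero (P := fun p => (p : ℕ) < s (i + 1)) hb hv hz ?_
          rw [hi1]
          simpa using ha) hv0)
      refine ⟨Function.update x i (x i + y), fun l => ?_, ?_, fun l hl => ?_, ?_⟩
      · rw [Function.update_of_ne, hxc l]
        intro h
        have := l.2
        rw [h] at this
        omega
      · rw [slack_update]
        exact hxs.add (hsym.smul _)
      · rw [Function.update_of_ne]
        · exact hxM l hl
        · rintro rfl
          omega
      · rw [slack_update, add_sub_cancel_left]
        exact hy
  obtain ⟨x, hxc, hxs, hxM, hxp⟩ := key (k - 1) (by omega)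
  refine ⟨x, hxc, posDef_iff_dotProduct_mulVec.2 ⟨by simpa [IsHermitian, IsSymm] using hxs, ?_⟩,
    hxM⟩
  intro v hv
  have e : k - (k - 1 + 1) = 0 := by omega
  simpa using hxp v (fun a ha => absurd (by simp [e, h0]) ha) hv

end LargeFeasiblePoints

/-! ### Merging two consecutive blocks, and what minimality forbids. -/

section Merging

variable {m n : ℕ}

theorem isReformulation_comp_perm (A : Fin m → Matrix (Fin n) (Fin n) ℝ)
    (B : Matrix (Fin n) (Fin n) ℝ) (σ : Equiv.Perm (Fin m)) :
    IsReformulation A B (A ∘ σ) B := by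
  induction σ using Equiv.Perm.swap_induction_on' with
  | one => exact Relation.ReflTransGen.refl
  | mul_swap f x y hxy ih => exact ih.tail (ReformStep.exchange (A ∘ f) B x y hxy)

theorem sum_eq_sum_subtype_of_support (J : Set (Fin n)) [DecidablePred (· ∈ J)] (F : Fin n → ℝ)
    (hF : ∀ a ∉ J, F a = 0) : ∑ a, F a = ∑ a : {a // a ∈ J}, F a := by
  rw [← Fintype.sum_subtype_add_sum_subtype (· ∈ J) F, add_eq_left]
  exact Finset.sum_eq_zero fun a _ => hF a a.2

open scoped MatrixOrder in
theorem Matrix.PosDef.exists_isUnit_transpose_mul_mul_eq_one {ι : Type*} [Fintype ι]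
    [DecidableEq ι] {C : Matrix ι ι ℝ} (hC : C.PosDef) :
    ∃ T : Matrix ι ι ℝ, IsUnit T ∧ Tᵀ * C * T = 1 := by
  obtain ⟨L, hL, rfl⟩ := CStarAlgebra.isStrictlyPositive_iff_eq_star_mul_self.1
    (isStrictlyPositive_iff_posDef.2 hC)
  have hd : IsUnit L.det := (isUnit_iff_isUnit_det L).1 hL
  refine ⟨L⁻¹, (isUnit_nonsing_inv_iff).2 hL, ?_⟩
  rw [star_eq_conjTranspose, conjTranspose_eq_transpose_of_trivial, ← mul_assoc, ← transpose_mul,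
    mul_nonsing_inv _ hd, transpose_one, one_mul, mul_nonsing_inv _ hd]

/-- A symmetric matrix that is positive definite on the vectors supported in `J` is brought to the
identity on `J` by a congruence that only acts on the coordinates in `J`. -/
theorem exists_congruence_eq_one_on (J : Set (Fin n)) {C : Matrix (Fin n) (Fin n) ℝ}
    (hC : C.IsSymm)
    (hpos : ∀ v : Fin n → ℝ, (∀ a ∉ J, v a = 0) → v ≠ 0 → 0 < v ⬝ᵥ (C *ᵥ v)) :
    ∃ T : Matrix (Fin n) (Fin n) ℝ, IsUnit T ∧
      (∀ a p, a ∉ J ∨ p ∉ J → T a p = if a = p then 1 else 0) ∧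
      ∀ p ∈ J, ∀ q ∈ J, (Tᵀ * C * T) p q = if p = q then 1 else 0 := by
  classical
  let e : Fin n ≃ {a // a ∈ J} ⊕ {a // a ∉ J} := (Equiv.sumCompl (· ∈ J)).symm
  have hpd : (C.submatrix (Subtype.val : {a // a ∈ J} → Fin n) Subtype.val).PosDef := by
    refine PosDef.of_dotProduct_mulVec_pos ?_ fun w hw => ?_
    · ext a b
      simp [hC.apply]
    · let v : Fin n → ℝ := fun a => if h : a ∈ J then w ⟨a, h⟩ else 0
      have hvJ : ∀ a ∉ J, v a = 0 := fun a ha => by simp [v, ha]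
      have hvw : ∀ a : {a // a ∈ J}, v a = w a := fun a => by simp [v]
      have hv : v ≠ 0 := by
        intro h
        refine hw (funext fun a => ?_)
        rw [← hvw a, h]
        rfl
      have := hpos v hvJ hv
      simp only [dotProduct, mulVec] at this ⊢
      rw [sum_eq_sum_subtype_of_support J _ (fun a ha => by simp [hvJ a ha])] at this
      refine this.trans_eq (Finset.sum_congr rfl fun a _ => ?_)
      rw [sum_eq_sum_subtype_of_support J _ (fun b hb => by simp [hvJ b hb])]
      simp [hvw]
  obtain ⟨T₀, hT₀, hT₁⟩ := hpd.exists_isUnit_transpose_mul_mul_eq_one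
  have hel : ∀ p (hp : p ∈ J), e p = Sum.inl ⟨p, hp⟩ :=
    fun p hp => Equiv.sumCompl_symm_apply_of_pos hp
  have her : ∀ p (hp : p ∉ J), e p = Sum.inr ⟨p, hp⟩ :=
    fun p hp => Equiv.sumCompl_symm_apply_of_neg hp
  -- With the coordinates in `J` listed first, `T` is `diag(T₀, 1)`, where `T₀` normalizes the
  -- `J`-block of `C`.
  refine ⟨(fromBlocks T₀ 0 0 1).submatrix e e, ?_, ?_, ?_⟩
  · rw [isUnit_submatrix_equiv, isUnit_iff_isUnit_det, det_fromBlocks_zero₂₁, det_one, mul_one]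
    exact (isUnit_iff_isUnit_det _).1 hT₀
  · intro a p h
    by_cases ha : a ∈ J <;> by_cases hp : p ∈ J
    · tauto
    · have : a ≠ p := fun h => hp (h ▸ ha)
      simp [hel a ha, her p hp, this]
    · have : a ≠ p := fun h => ha (h ▸ hp)
      simp [her a ha, hel p hp, this]
    · simp [her a ha, her p hp, Matrix.one_apply]
  · intro p hp q hq
    have hCe : C = (C.submatrix e.symm e.symm).submatrix e e := by simp
    have h11 : (C.submatrix e.symm e.symm).toBlocks₁₁ =
        C.submatrix (Subtype.val : {a // a ∈ J} → Fin n) Subtype.val := by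
      ext a b
      simp [toBlocks₁₁, e]
    rw [hCe, transpose_submatrix, submatrix_mul_equiv, submatrix_mul_equiv,
      ← fromBlocks_toBlocks (C.submatrix e.symm e.symm), fromBlocks_transpose, fromBlocks_multiply,
      fromBlocks_multiply, submatrix_apply, hel p hp, hel q hq, fromBlocks_apply₁₁, h11]
    simp [hT₁, Matrix.one_apply]

theorem transpose_mul_mul_apply (M T : Matrix (Fin n) (Fin n) ℝ) (p q : Fin n) :
    (Tᵀ * M * T) p q = ∑ b, (∑ a, T a p * M a b) * T b q := by
  simp [Matrix.mul_apply]

theorem Matrix.IsSymm.transpose_mul_mul {M : Matrix (Fin n) (Fin n) ℝ} (hM : M.IsSymm)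
    (T : Matrix (Fin n) (Fin n) ℝ) : (Tᵀ * M * T).IsSymm := by
  simp [IsSymm, Matrix.transpose_mul, hM.eq, Matrix.mul_assoc]

/-- A congruence acting on the coordinates in `J` preserves a block `diag(I, 0)` on `U ⊇ J` if `J`
avoids the coordinates of the identity block. -/
theorem congruence_apply_of_block {J U : Set (Fin n)} {P : Fin n → Prop} [DecidablePred P]
    {M T : Matrix (Fin n) (Fin n) ℝ} (hJU : J ⊆ U) (hPJ : ∀ a, P a → a ∉ J)
    (hM : ∀ p ∈ U, ∀ q ∈ U, M p q = if p = q ∧ P p then 1 else 0)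
    (hT : ∀ a p, a ∉ J ∨ p ∉ J → T a p = if a = p then 1 else 0) :
    ∀ p ∈ U, ∀ q ∈ U, (Tᵀ * M * T) p q = if p = q ∧ P p then 1 else 0 := by
  intro p hp q hq
  have hTU : ∀ a ∉ U, ∀ p ∈ U, T a p = 0 := by
    intro a ha p hp
    have : a ≠ p := fun h => ha (h ▸ hp)
    rw [hT a p (Or.inl fun h => ha (hJU h)), if_neg this]
  have hterm : ∀ b, (∑ a, T a p * M a b) * T b q =
      if b = q then (if p = q ∧ P p then 1 else 0) else 0 := by
    intro b
    by_cases hb : b ∈ U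
    · have hin : ∀ a, T a p * M a b = if a = b then (if P b then T b p else 0) else 0 := by
        intro a
        by_cases ha : a ∈ U
        · rw [hM a ha b hb]
          by_cases hab : a = b
          · subst hab
            by_cases hPa : P a <;> simp [hPa]
          · simp [hab]
        · have hab : a ≠ b := fun h => ha (h ▸ hb)
          simp [hTU a ha p hp, hab]
      rw [Finset.sum_congr rfl fun a _ => hin a, Finset.sum_ite_eq']
      simp only [Finset.mem_univ, if_true]
      by_cases hPb : P b
      · rw [hT b p (Or.inl (hPJ b hPb)), hT b q (Or.inl (hPJ b hPb))]
        by_cases hbq : b = q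
        · subst hbq
          by_cases hbp : b = p
          · subst hbp
            simp [hPb]
          · simp [hPb, hbp, Ne.symm hbp]
        · simp [hbq]
      · by_cases hbq : b = q
        · subst hbq
          have : ¬(p = b ∧ P p) := fun h => hPb (h.1 ▸ h.2)
          simp [hPb, this]
        · simp [hPb, hbq]
    · have hbq : b ≠ q := fun h => hb (h ▸ hq)
      simp [hTU b hb q hq, hbq]
  rw [transpose_mul_mul_apply, Finset.sum_congr rfl fun b _ => hterm b, Finset.sum_ite_eq']
  simp

/-- The permutation of `Fin m` that moves the index `j` to the end. -/
theorem exists_perm_move_to_end {j : ℕ} (hj : j + 1 < m) :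
    ∃ σ : Equiv.Perm (Fin m), ∀ i : Fin m, ((i : ℕ) < j → σ i = i) ∧
      ∀ (h : (i : ℕ) + 1 < m), j ≤ (i : ℕ) → σ i = ⟨i + 1, h⟩ := by
  let g : Fin m → Fin m := fun i =>
    if (i : ℕ) < j then i else if h : (i : ℕ) + 1 < m then ⟨i + 1, h⟩ else ⟨j, by omega⟩
  have hg : Function.Injective g := by
    intro a b hab
    simp only [g] at hab
    split_ifs at hab <;> simp only [Fin.ext_iff] at hab ⊢ <;> omega
  refine ⟨Equiv.ofBijective g (Finite.injective_iff_bijective.1 hg), fun i => ⟨fun h => ?_,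
    fun h h' => ?_⟩⟩
  · simp [g, h]
  · simp [g, h, not_lt.2 h']

/-- Two consecutive matrices of a regular facial reduction sequence can be merged into one if the
second has no entries in the rows of the block of the first outside the columns of the two blocks
and of the previous ones. -/
theorem IsOffsetFRSeq.exists_merge {k : ℕ} {s : ℕ → ℕ} {A : Fin m → Matrix (Fin n) (Fin n) ℝ}
    (hA : IsOffsetFRSeq k s A) (B : Matrix (Fin n) (Fin n) ℝ) (hk : k ≤ m) {i₀ i₁ : Fin m}
    (hi : (i₁ : ℕ) = i₀ + 1) (hi₁ : (i₁ : ℕ) < k)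
    (hzero : ∀ p q : Fin n, s i₀ ≤ p → (p : ℕ) < s i₁ → s (i₁ + 1) ≤ q → A i₁ p q = 0) :
    ∃ A' B', IsReformulation A B A' B' ∧ ∃ s', IsOffsetFRSeq (k - 1) s' A' ∧ s' (k - 1) = s k := by
  obtain ⟨hs, h0, hA⟩ := hA
  obtain ⟨hsym₀, hb₀⟩ := hA i₀ (by omega)
  obtain ⟨hsym₁, hb₁⟩ := hA i₁ hi₁
  rw [← hi] at hb₀
  have hs₀ : s i₀ ≤ s i₁ := hs (by omega)
  have hs₁ : s i₁ ≤ s (i₁ + 1) := hs (by omega)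
  set J : Set (Fin n) := {a | s i₀ ≤ a ∧ (a : ℕ) < s (i₁ + 1)} with hJ
  -- On `J` the form of `A i₀` vanishes only on vectors supported in the second block, where `A i₁`
  -- is the identity.
  obtain ⟨c, hc⟩ := exists_add_smul_pos_on_support J (A i₁) (A i₀)
    (fun v hv => quadForm_nonneg_of_block (P := fun p => (p : ℕ) < s i₁)
      (fun p hp q hq => hb₀ p q hp.1 hq.1) hv)
    (fun v hv hv0 hz => by
      have hv₁ : ∀ a ∉ {a : Fin n | s i₁ ≤ a}, v a = 0 := fun a ha =>
        eq_zero_of_quadForm_block_eq_zero (P := fun p => (p : ℕ) < s i₁)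
          (fun p hp q hq => hb₀ p q hp.1 hq.1) hv hz (by simpa using ha)
      refine lt_of_le_of_ne (quadForm_nonneg_of_block (P := fun p => (p : ℕ) < s (i₁ + 1))
        (fun p hp q hq => hb₁ p q hp hq) hv₁) fun hne => hv0 (funext fun a => ?_)
      by_cases ha : (a : ℕ) < s (i₁ + 1)
      · exact eq_zero_of_quadForm_block_eq_zero (P := fun p => (p : ℕ) < s (i₁ + 1))
          (fun p hp q hq => hb₁ p q hp hq) hv₁ hne.symm ha
      · exact hv a fun h => ha h.2)
  set C := A i₁ + c • A i₀ with hCdef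
  have hCsym : C.IsSymm := hsym₁.add (hsym₀.smul c)
  obtain ⟨T, hTu, hTJ, hT1⟩ := exists_congruence_eq_one_on J hCsym hc
  -- `A i₀` is discarded behind all the others; the combination `C` slides into its position and the
  -- later matrices move down by one.
  obtain ⟨σ, hσ⟩ := exists_perm_move_to_end (m := m) (j := i₀) (by omega)
  set A₁ := Function.update A i₁ ((1 : ℝ) • A i₁ + c • A i₀) with hA₁
  have hstep : IsReformulation A B A₁ B :=
    Relation.ReflTransGen.single
      (ReformStep.combine A B i₁ i₀ 1 c one_ne_zero (Or.inl fun h => by omega))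
  -- The new offsets omit `s i₁`, the boundary between the two merged blocks.
  obtain ⟨s', hs'₁, hs'₂⟩ : ∃ s' : ℕ → ℕ, (∀ i : ℕ, i ≤ i₀ → s' i = s i) ∧
      ∀ i : ℕ, i₀ < i → s' i = s (i + 1) :=
    ⟨fun i => if i ≤ i₀ then s i else s (i + 1), fun i h => if_pos h, fun i h => if_neg (by omega)⟩
  refine ⟨fun i => Tᵀ * (A₁ ∘ σ) i * T, Tᵀ * B * T,
    (hstep.trans (isReformulation_comp_perm A₁ B σ)).tail (ReformStep.rotate _ _ T hTu),
    s', ⟨?_, by rw [hs'₁ 0 (Nat.zero_le _), h0], ?_⟩, ?_⟩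
  · intro a b hab
    rcases le_or_gt a i₀ with ha | ha <;> rcases le_or_gt b i₀ with hb | hb
    · rw [hs'₁ a ha, hs'₁ b hb]
      exact hs hab
    · rw [hs'₁ a ha, hs'₂ b hb]
      exact hs (by omega)
    · omega
    · rw [hs'₂ a ha, hs'₂ b hb]
      exact hs (by omega)
  · intro i hik
    rcases lt_trichotomy (i : ℕ) i₀ with hlt | heq | hgt
    · have hval : (A₁ ∘ σ) i = A i := by
        simp only [Function.comp, (hσ i).1 hlt, hA₁]
        exact Function.update_of_ne (fun h => by omega) _ _
      obtain ⟨hsym, hb⟩ := hA i (by omega)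
      have hle : s (i + 1) ≤ s i₀ := hs (by omega)
      have hle' : s i ≤ s i₀ := hs (by omega)
      simp only [hval]
      rw [hs'₁ i (by omega), hs'₁ (i + 1) (by omega)]
      refine ⟨hsym.transpose_mul_mul T, fun p q hp hq => ?_⟩
      -- For an earlier matrix, `J` lies past its identity block, in the part where it is zero.
      refine congruence_apply_of_block (J := J) (U := {a : Fin n | s i ≤ a})
        (P := fun p => (p : ℕ) < s (i + 1)) (fun a ha => hle'.trans ha.1) (fun a ha haJ => ?_)
        (fun p hp q hq => hb p q hp hq) hTJ p hp q hq
      have := haJ.1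
      omega
    · have hii : i = i₀ := Fin.ext heq
      subst hii
      have hval : (A₁ ∘ σ) i = C := by
        have : σ i = i₁ := by
          rw [(hσ i).2 (by omega) le_rfl]
          exact Fin.ext hi.symm
        simp [Function.comp, this, hA₁, hCdef]
      simp only [hval]
      rw [hs'₁ i le_rfl, hs'₂ (i + 1) (by omega), ← hi]
      have hTC := hCsym.transpose_mul_mul T
      -- The column of `T` at `p` is trivial, so only row `p` of `C` matters. Its entries in the
      -- columns of the first block vanish by `hzero`, those further right by the block structure;
      -- columns before `J` are not mixed in by `T`.
      have hout : ∀ p q : Fin n, s (i₁ + 1) ≤ p → s i ≤ q → (Tᵀ * C * T) p q = 0 := by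
        intro p q hp hq
        rw [transpose_mul_mul_apply]
        refine Finset.sum_eq_zero fun b _ => ?_
        have hpJ : p ∉ J := fun h => by have := h.2; omega
        have hin : ∑ a, T a p * C a b = C p b := by
          rw [Finset.sum_eq_single p]
          · simp [hTJ p p (Or.inl hpJ)]
          · intro a _ hap
            simp [hTJ a p (Or.inr hpJ), hap]
          · simp
        rw [hin]
        by_cases hb : s i ≤ (b : ℕ)
        · have e0 : A i p b = 0 := by
            rw [hb₀ p b (by omega) hb, if_neg]
            rintro ⟨-, h⟩
            omega
          have e1 : A i₁ p b = 0 := by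
            by_cases hb' : s i₁ ≤ (b : ℕ)
            · rw [hb₁ p b (by omega) hb', if_neg]
              rintro ⟨-, h⟩
              omega
            · rw [← hsym₁.apply]
              exact hzero b p hb (by omega) hp
          simp [hCdef, e0, e1]
        · have hbJ : b ∉ J := fun h => hb h.1
          have hbq : b ≠ q := fun h => hb (h ▸ hq)
          simp [hTJ b q (Or.inl hbJ), hbq]
      refine ⟨hTC, fun p q hp hq => ?_⟩
      by_cases hp' : (p : ℕ) < s (i₁ + 1)
      · by_cases hq' : (q : ℕ) < s (i₁ + 1)
        · simp [hT1 p ⟨hp, hp'⟩ q ⟨hq, hq'⟩, hp']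
        · have hpq : p ≠ q := fun h => hq' (h ▸ hp')
          rw [← hTC.apply, hout q p (by omega) hp]
          simp [hpq]
      · rw [hout p q (by omega) hq]
        simp [hp']
    · have him : (i : ℕ) + 1 < m := by omega
      have hval : (A₁ ∘ σ) i = A ⟨i + 1, him⟩ := by
        simp only [Function.comp, (hσ i).2 him hgt.le, hA₁]
        refine Function.update_of_ne (fun h => ?_) _ _
        have := congrArg Fin.val h
        simp only at this
        omega
      obtain ⟨hsym, hb⟩ := hA ⟨i + 1, him⟩ (by simp only; omega)
      simp only [hval]
      rw [hs'₂ i hgt, hs'₂ (i + 1) (by omega)]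
      refine ⟨hsym.transpose_mul_mul T, fun p q hp hq => ?_⟩
      have hle : s (i₁ + 1) ≤ s (i + 1) := hs (by omega)
      -- A later matrix is constrained only at indices past `J`, where the columns of `T` are those
      -- of the identity.
      have hnJ : ∀ a : Fin n, s (i + 1) ≤ a → a ∉ J := fun a ha h => by
        have := h.2
        omega
      rw [transpose_mul_mul_apply, Finset.sum_eq_single q, Finset.sum_eq_single p]
      · rw [hTJ p p (Or.inl (hnJ p hp)), hTJ q q (Or.inl (hnJ q hq)), if_pos rfl, if_pos rfl,
          one_mul, mul_one]
        exact hb p q hp hq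
      · intro a _ hap
        simp [hTJ a p (Or.inr (hnJ p hp)), hap]
      · simp
      · intro b _ hbq
        simp [hTJ b q (Or.inr (hnJ q hq)), hbq]
      · simp
  · rw [hs'₂ (k - 1) (by omega)]
    congr 1
    omega

/-- For a minimal regularized form, the matrix after a block has a nonzero entry in the rows of
that block and beyond the columns of its own. -/
theorem exists_entry_ne_zero_of_minimal {k : ℕ} {s : ℕ → ℕ}
    {A A' : Fin m → Matrix (Fin n) (Fin n) ℝ} {B B' : Matrix (Fin n) (Fin n) ℝ}
    (href : IsReformulation A B A' B') (hA' : IsOffsetFRSeq k s A') (hk : k ≤ m) (hn : s k ≤ n)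
    (hgr : IsGreatest (dualRanks A) (n - s k))
    (hmin : ∀ (k' : ℕ) (A'' : Fin m → Matrix (Fin n) (Fin n) ℝ) (B'' : Matrix (Fin n) (Fin n) ℝ),
      IsRegularizedForm A B k' A'' B'' → k ≤ k')
    {i₀ i₁ : Fin m} (hi : (i₁ : ℕ) = i₀ + 1) (hi₁ : (i₁ : ℕ) < k) :
    ∃ p q : Fin n, s i₀ ≤ p ∧ (p : ℕ) < s i₁ ∧ s (i₁ + 1) ≤ q ∧ A' i₁ p q ≠ 0 := by
  -- Merging preserves the total block size `s k`, so the rank condition survives with `k - 1`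
  -- matrices.
  by_contra! hcon
  obtain ⟨A'', B'', href', s', hA'', hs'⟩ :=
    hA'.exists_merge B' hk hi hi₁ fun p q h1 h2 h3 => hcon p q h1 h2 h3
  obtain ⟨r, hr, hsum⟩ := hA''.isRegularFRSeq (by omega) (hs'.trans_le hn)
  have := hmin (k - 1) A'' B''
    ⟨href.trans href', by omega, r, hr, by rw [hsum, hs']; exact hgr⟩
  omega

end Merging

/-! ### Growth estimates from 2 × 2 minors. -/

section Growth

open Filter Asymptotics Topology

/-- Inserting the bound on `h` and dividing by `g ^ β` gives `c g^(2-β) ≤ C D f + C² D g`. As `2 - β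
> 1`, the term linear in `g` is eventually at most half of the left side, whence the factor 2 in
`E`. -/
theorem exists_rpow_le_of_mul_sq_le {ι : Type*} {l : Filter ι} {f g h : ι → ℝ} {c C D β : ℝ}
    (hc : 0 < c) (hC : 0 < C) (hD : 0 < D) (hβ : β < 1) (hg : Tendsto g l atTop)
    (hle : ∀ᶠ x in l, c * g x ^ 2 ≤ C * h x * (f x + C * g x))
    (hnonneg : ∀ᶠ x in l, 0 ≤ f x + C * g x)
    (hh : ∀ᶠ x in l, h x ≤ D * g x ^ β) :
    ∃ E > 0, ∀ᶠ x in l, g x ^ (2 - β) ≤ E * f x := by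
  refine ⟨2 * C * D / c, by positivity, ?_⟩
  have hlim : Tendsto (fun x => g x ^ (1 - β)) l atTop :=
    (tendsto_rpow_atTop (by linarith : 0 < 1 - β)).comp hg
  filter_upwards [hle, hnonneg, hh, hg.eventually_ge_atTop 1,
    hlim.eventually_ge_atTop (2 * (C * D * C) / c)] with x h1 h2 h3 h4 h5
  have hg0 : 0 < g x := by linarith
  have hgb : 0 < g x ^ β := Real.rpow_pos_of_pos hg0 β
  have e1 : g x ^ 2 = g x ^ (2 - β) * g x ^ β := by
    rw [← Real.rpow_add hg0, sub_add_cancel, Real.rpow_two]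
  have e2 : g x ^ (2 - β) = g x ^ (1 - β) * g x := by
    rw [show 2 - β = (1 - β) + 1 by ring, Real.rpow_add hg0, Real.rpow_one]
  have h6 : c * g x ^ 2 ≤ C * (D * g x ^ β) * (f x + C * g x) :=
    h1.trans (mul_le_mul_of_nonneg_right (mul_le_mul_of_nonneg_left h3 hC.le) h2)
  have h7 : c * g x ^ (2 - β) ≤ C * D * (f x + C * g x) := by
    refine le_of_mul_le_mul_right ?_ hgb
    calc c * g x ^ (2 - β) * g x ^ β = c * g x ^ 2 := by rw [e1]; ring
      _ ≤ _ := h6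
      _ = _ := by ring
  have h8 : 2 * (C * D * C) * g x ≤ c * g x ^ (2 - β) := by
    rw [div_le_iff₀ hc] at h5
    rw [e2]
    nlinarith
  rw [div_mul_eq_mul_div, le_div_iff₀ hc]
  linarith

theorem Matrix.PosDef.sq_apply_lt_mul {n : ℕ} {S : Matrix (Fin n) (Fin n) ℝ} (hS : S.PosDef)
    {p q : Fin n} (hpq : p ≠ q) : S p q ^ 2 < S p p * S q q := by
  have hinj : Function.Injective ![p, q] := by
    intro a b
    fin_cases a <;> fin_cases b <;> simp [hpq, hpq.symm]
  have h := (hS.submatrix hinj).det_pos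
  have hsym : S q p = S p q := by simpa using hS.isHermitian.apply p q
  rw [det_fin_two] at h
  simp only [submatrix_apply, cons_val_zero, cons_val_one, hsym] at h
  linarith [sq (S p q)]

variable {m n : ℕ}

/-- The variable with index `i < k`, continued by the constant `1` for `i ≥ k`. -/
noncomputable def leadingVar {m k : ℕ} (hk : k ≤ m) (i : ℕ) (x : Fin m → ℝ) : ℝ :=
  if h : i < k then x ⟨i, h.trans_le hk⟩ else 1

theorem leadingVar_of_lt {k : ℕ} (hk : k ≤ m) (i : Fin m) (hi : (i : ℕ) < k) (x : Fin m → ℝ) :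
    leadingVar hk i x = x i := by
  simp [leadingVar, hi]

theorem leadingVar_of_ge {k : ℕ} (hk : k ≤ m) {i : ℕ} (hi : k ≤ i) :
    leadingVar hk i = fun _ => 1 := by
  funext x
  simp [leadingVar, not_lt.2 hi]

theorem leadingVar_isBigO_of_le {k : ℕ} (hk : k ≤ m) {l : Filter (Fin m → ℝ)} {j i : ℕ}
    (hmono : ∀ i, j ≤ i → i < k → leadingVar hk (i + 1) =O[l] leadingVar hk i)
    (hji : j ≤ i) : leadingVar hk i =O[l] leadingVar hk j := by
  induction i, hji using Nat.le_induction with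
  | base => exact isBigO_refl _ _
  | succ i hji ih =>
    rcases lt_or_ge i k with h | h
    · exact (hmono i hji h).trans ih
    · rw [leadingVar_of_ge hk h] at ih
      rwa [leadingVar_of_ge hk (h.trans (Nat.le_succ i))]

/-- The terms before `j` vanish, the reducing variables after `j` are dominated by the next one, and
the fixed tail together with `B` is bounded. The value 1 of `leadingVar` from `k` onwards absorbs
these constants even when `j` is the last reducing index. -/
theorem slack_apply_sub_isBigO {k : ℕ} (hk : k ≤ m) {l : Filter (Fin m → ℝ)}
    {A : Fin m → Matrix (Fin n) (Fin n) ℝ} {B : Matrix (Fin n) (Fin n) ℝ}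
    {xbar : {i : Fin m // k ≤ (i : ℕ)} → ℝ} (hl : ∀ᶠ x in l, Completes xbar x)
    (j : Fin m)
    (hmono : ∀ i, (j : ℕ) + 1 ≤ i → i < k → leadingVar hk (i + 1) =O[l] leadingVar hk i)
    {p q : Fin n} (hzero : ∀ i < j, A i p q = 0) :
    (fun x => slack A B x p q - x j * A j p q) =O[l] leadingVar hk (j + 1) := by
  have hchain : ∀ i, (j : ℕ) + 1 ≤ i → leadingVar hk i =O[l] leadingVar hk (j + 1) :=
    fun i hi => leadingVar_isBigO_of_le hk hmono hi
  have hone : ∀ c : ℝ, (fun _ => c) =O[l] leadingVar hk (j + 1) := by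
    intro c
    have h1 := hchain (max k (j + 1)) (le_max_right _ _)
    rw [leadingVar_of_ge hk (le_max_left _ _)] at h1
    exact (isBigO_const_const c one_ne_zero l).trans h1
  have heq : (fun x => slack A B x p q - x j * A j p q) =
      fun x => (∑ i ∈ Finset.univ.erase j, x i * A i p q) + B p q := by
    funext x
    simp only [slack, Matrix.add_apply, Matrix.sum_apply, Matrix.smul_apply, smul_eq_mul]
    rw [← Finset.add_sum_erase _ _ (Finset.mem_univ j)]
    ring
  rw [heq]
  refine (IsBigO.fun_sum fun i hi => ?_).add (hone _)
  have hij : i ≠ j := Finset.ne_of_mem_erase hi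
  rcases lt_or_gt_of_ne hij with h | h
  · simp only [hzero i h, mul_zero]
    exact isBigO_zero _ _
  · rcases lt_or_ge (i : ℕ) k with hik | hik
    · have h1 := (hchain i h).const_mul_left (A i p q)
      refine h1.congr_left fun x => ?_
      rw [leadingVar_of_lt hk i hik, mul_comm]
    · refine (hone (xbar ⟨i, hik⟩ * A i p q)).congr' ?_ EventuallyEq.rfl
      filter_upwards [hl] with x hx
      rw [← hx ⟨i, hik⟩]

/-- The growth relations at the `i`-th variable along a filter. -/
structure GrowsAt {k : ℕ} (hk : k ≤ m) (l : Filter (Fin m → ℝ)) (i : ℕ) : Prop where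
  tendsto : Tendsto (leadingVar hk i) l atTop
  isLittleO : leadingVar hk (i + 1) =o[l] leadingVar hk i
  exists_le_rpow : ∃ D > 0, ∀ᶠ x in l,
    leadingVar hk (i + 1) x ≤ D * leadingVar hk i x ^ (((k : ℝ) - i - 1) / (k - i))
  exists_rpow_le : i + 1 < k → ∃ E > 0, ∀ᶠ x in l,
    leadingVar hk (i + 1) x ^ (1 + 1 / ((k : ℝ) - (i + 1))) ≤ E * leadingVar hk i x

/-- The power bound implies the other growth relations: its exponent `α` exceeds 1, which gives
divergence and the little-o, and `1 / α` is the exponent required in `exists_le_rpow`. -/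
theorem GrowsAt.of_rpow_le {k : ℕ} (hk : k ≤ m) {l : Filter (Fin m → ℝ)} {i : ℕ} (hik : i + 1 < k)
    (htend : Tendsto (leadingVar hk (i + 1)) l atTop) {E : ℝ} (hE : 0 < E)
    (h : ∀ᶠ x in l,
      leadingVar hk (i + 1) x ^ (1 + 1 / ((k : ℝ) - (i + 1))) ≤ E * leadingVar hk i x) :
    GrowsAt hk l i := by
  have hki : (0 : ℝ) < (k : ℝ) - (i + 1) := by
    have : ((i + 1 : ℕ) : ℝ) < k := by exact_mod_cast hik
    push_cast at this
    linarith
  set α : ℝ := 1 + 1 / ((k : ℝ) - (i + 1)) with hα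
  have hα1 : 1 < α := by
    rw [hα]
    have : 0 < 1 / ((k : ℝ) - (i + 1)) := by positivity
    linarith
  have hpow : Tendsto (fun x => leadingVar hk (i + 1) x ^ α) l atTop :=
    (tendsto_rpow_atTop (by linarith)).comp htend
  have hi : Tendsto (leadingVar hk i) l atTop := by
    have h1 : Tendsto (fun x => E * leadingVar hk i x) l atTop := tendsto_atTop_mono' l h hpow
    exact (tendsto_const_mul_atTop_of_pos hE).1 h1
  refine ⟨hi, ?_, ⟨E ^ (1 / α), by positivity, ?_⟩, fun _ => ⟨E, hE, h⟩⟩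
  · rw [isLittleO_iff]
    intro c hc
    have h2 : Tendsto (fun x => leadingVar hk (i + 1) x ^ (α - 1)) l atTop :=
      (tendsto_rpow_atTop (by linarith)).comp htend
    filter_upwards [h, htend.eventually_gt_atTop 0, hi.eventually_gt_atTop 0,
      h2.eventually_ge_atTop (E / c)] with x h3 h4 h5 h6
    rw [Real.norm_of_nonneg h4.le, Real.norm_of_nonneg h5.le]
    have e : leadingVar hk (i + 1) x ^ α =
        leadingVar hk (i + 1) x ^ (α - 1) * leadingVar hk (i + 1) x := by
      rw [← Real.rpow_add_one h4.ne', sub_add_cancel]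
    rw [e] at h3
    have h7 : E / c * leadingVar hk (i + 1) x ≤ E * leadingVar hk i x :=
      (mul_le_mul_of_nonneg_right h6 h4.le).trans h3
    rw [div_mul_eq_mul_div, div_le_iff₀ hc, mul_assoc] at h7
    have := le_of_mul_le_mul_left h7 hE
    linarith
  · filter_upwards [h, htend.eventually_gt_atTop 0, hi.eventually_gt_atTop 0] with x h3 h4 h5
    have hexp : ((k : ℝ) - i - 1) / (k - i) = 1 / α := by
      have : (k : ℝ) - i ≠ 0 := by linarith
      have h8 : (k : ℝ) - (i + 1) + 1 ≠ 0 := by linarith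
      rw [hα]
      field_simp
      ring
    rw [hexp, ← Real.mul_rpow hE.le h5.le]
    calc leadingVar hk (i + 1) x = (leadingVar hk (i + 1) x ^ α) ^ (1 / α) := by
          rw [← Real.rpow_mul h4.le, mul_one_div_cancel (by linarith), Real.rpow_one]
      _ ≤ _ := Real.rpow_le_rpow (by positivity) h3 (by positivity)

/-- Inductive step, from the minor of the slack on rows `p`, `q`. At `(p, p)` the leading term is `x
i₀`, at `(p, q)` it is `x i₁ * A i₁ p q`, and at `(q, q)` every matrix up to `i₁` vanishes. -/
theorem growsAt_of_forall_gt {k : ℕ} (hk : k ≤ m) {l : Filter (Fin m → ℝ)} {s : ℕ → ℕ}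
    {A : Fin m → Matrix (Fin n) (Fin n) ℝ} {B : Matrix (Fin n) (Fin n) ℝ}
    (hA : IsOffsetFRSeq k s A)
    {xbar : {i : Fin m // k ≤ (i : ℕ)} → ℝ} (hl : ∀ᶠ x in l, Completes xbar x)
    (hfeas : ∀ᶠ x in l, StrictlyFeasible A B x)
    {i₀ i₁ : Fin m} (hi : (i₁ : ℕ) = i₀ + 1) (hi₁ : (i₁ : ℕ) < k)
    (hentry : ∃ p q : Fin n, s i₀ ≤ p ∧ (p : ℕ) < s i₁ ∧ s (i₁ + 1) ≤ q ∧ A i₁ p q ≠ 0)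
    (hgrow : ∀ i, (i₁ : ℕ) ≤ i → i < k → GrowsAt hk l i) : GrowsAt hk l i₀ := by
  obtain ⟨hs, h0, hA⟩ := hA
  obtain ⟨p, q, hp, hp', hq, hpq0⟩ := hentry
  have hs₁ : s i₁ ≤ s (i₁ + 1) := hs (by omega)
  have hpq : p ≠ q := fun h => by
    have := congrArg Fin.val h
    omega
  have hmono : ∀ i, (i₁ : ℕ) ≤ i → i < k → leadingVar hk (i + 1) =O[l] leadingVar hk i :=
    fun i h1 h2 => (hgrow i h1 h2).isLittleO.isBigO
  have hg := hgrow i₁ le_rfl hi₁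
  have hzero : ∀ i : Fin m, ∀ a b : Fin n, (i : ℕ) < k → s (i : ℕ) ≤ a → s (i + 1) ≤ b →
      (a ≠ b ∨ s (i + 1) ≤ (a : ℕ)) → A i a b = 0 := by
    intro i a b hik ha hb hor
    rw [(hA i hik).2 a b ha ((hs (Nat.le_succ _)).trans hb), if_neg]
    rintro ⟨h1, h2⟩
    rcases hor with h | h
    · exact h h1
    · omega
  have hlow : ∀ i : Fin m, i < i₀ → s i ≤ s i₀ ∧ s (i + 1) ≤ s i₀ := fun i hii =>
    ⟨hs (by omega), hs (by omega)⟩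
  have hlow₁ : ∀ i : Fin m, i ≤ i₁ → s i ≤ s (i₁ + 1) ∧ s (i + 1) ≤ s (i₁ + 1) := fun i hii =>
    ⟨hs (by omega), hs (by omega)⟩
  have hs₀ : s i₀ ≤ s i₁ := hs (by omega)
  have hpp : (fun x => slack A B x p p - x i₀ * A i₀ p p) =O[l] leadingVar hk (i₀ + 1) :=
    slack_apply_sub_isBigO hk hl i₀ (fun i h1 h2 => hmono i (by omega) h2) fun i hii => by
      have := hlow i hii
      exact hzero i p p (by omega) (by omega) (by omega) (Or.inr (by omega))
  have hqq : (fun x => slack A B x q q - x i₁ * A i₁ q q) =O[l] leadingVar hk (i₁ + 1) :=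
    slack_apply_sub_isBigO hk hl i₁ (fun i h1 h2 => hmono i (by omega) h2) fun i hii => by
      have := hlow₁ i hii.le
      exact hzero i q q (by omega) (by omega) (by omega) (Or.inr (by omega))
  have hpq' : (fun x => slack A B x p q - x i₁ * A i₁ p q) =O[l] leadingVar hk (i₁ + 1) :=
    slack_apply_sub_isBigO hk hl i₁ (fun i h1 h2 => hmono i (by omega) h2) fun i hii => by
      have := hlow₁ i hii.le
      rcases eq_or_ne i i₀ with rfl | hne
      · exact hzero i p q (by omega) hp (by omega) (Or.inl hpq)
      · have := hlow i (by omega)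
        exact hzero i p q (by omega) (by omega) (by omega) (Or.inl hpq)
  have hpp1 : A i₀ p p = 1 := by
    rw [(hA i₀ (by omega)).2 p p hp hp, if_pos ⟨rfl, hi ▸ hp'⟩]
  have hqq0 : A i₁ q q = 0 := hzero i₁ q q hi₁ (by omega) hq (Or.inr hq)
  simp only [hpp1, hqq0, mul_one, mul_zero, sub_zero] at hpp hqq
  rw [← hi] at hpp
  have hpo := hpq'.trans_isLittleO hg.isLittleO
  obtain ⟨C₁, hC₁, hpp⟩ := hpp.exists_pos
  obtain ⟨C₂, hC₂, hqq⟩ := hqq.exists_pos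
  obtain ⟨D, hD, hle⟩ := hg.exists_le_rpow
  -- Half of the coefficient is given up to absorb the little-o error in the entry `(p, q)`.
  set c : ℝ := |A i₁ p q| / 2 with hc
  have hcpos : 0 < c := by positivity
  set C := max C₁ C₂
  have hCpos : 0 < C := lt_max_of_lt_left hC₁
  have hnext : ∀ᶠ x in l, 0 ≤ leadingVar hk (i₁ + 1) x := by
    rcases lt_or_ge ((i₁ : ℕ) + 1) k with h | h
    · exact (hgrow _ (by omega) h).tendsto.eventually_ge_atTop 0
    · simp [leadingVar_of_ge hk h]
  have hSpp : ∀ᶠ x in l, slack A B x p p ≤ leadingVar hk i₀ x + C * leadingVar hk i₁ x := by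
    filter_upwards [hpp.bound, hg.tendsto.eventually_ge_atTop 0] with x h1 h2
    rw [Real.norm_of_nonneg h2, Real.norm_eq_abs] at h1
    rw [leadingVar_of_lt hk i₀ (by omega)]
    have := mul_le_mul_of_nonneg_right (le_max_left C₁ C₂) h2
    linarith [le_abs_self (slack A B x p p - x i₀)]
  have hβ : ((k : ℝ) - i₁ - 1) / (k - i₁) < 1 := by
    have : ((i₁ : ℕ) : ℝ) < k := by exact_mod_cast hi₁
    rw [div_lt_one (by linarith)]
    linarith
  obtain ⟨E, hE, hfin⟩ := exists_rpow_le_of_mul_sq_le (l := l) (f := leadingVar hk i₀)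
    (g := leadingVar hk i₁) (h := leadingVar hk (i₁ + 1)) (c := c ^ 2) (C := C) (D := D)
    (β := ((k : ℝ) - i₁ - 1) / (k - i₁)) (by positivity) hCpos hD hβ hg.tendsto
    (by
      filter_upwards [hfeas, hSpp, hqq.bound, hpo.bound hcpos,
        hg.tendsto.eventually_ge_atTop 0, hnext] with x hx h1 h2 h3 h4 h5
      have hx' : (slack A B x).PosDef := hx
      have hminor := hx'.sq_apply_lt_mul hpq
      have hppos := hx'.diag_pos (i := p)
      have hqpos := hx'.diag_pos (i := q)
      rw [Real.norm_of_nonneg hqpos.le, Real.norm_of_nonneg h5] at h2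
      rw [Real.norm_of_nonneg h4, Real.norm_eq_abs] at h3
      rw [← leadingVar_of_lt hk i₁ hi₁ x] at h3
      have h6 : slack A B x q q ≤ C * leadingVar hk (i₁ + 1) x :=
        h2.trans (mul_le_mul_of_nonneg_right (le_max_right C₁ C₂) h5)
      have h7 : c * leadingVar hk i₁ x ≤ |slack A B x p q| := by
        have h8 : |leadingVar hk i₁ x * A i₁ p q| = 2 * (c * leadingVar hk i₁ x) := by
          rw [abs_mul, abs_of_nonneg h4, hc]
          ring
        have h9 := abs_sub_abs_le_abs_sub (leadingVar hk i₁ x * A i₁ p q) (slack A B x p q)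
        rw [abs_sub_comm] at h9
        linarith
      calc c ^ 2 * leadingVar hk i₁ x ^ 2 = (c * leadingVar hk i₁ x) ^ 2 := by ring
        _ ≤ |slack A B x p q| ^ 2 := by gcongr
        _ = slack A B x p q ^ 2 := sq_abs _
        _ ≤ slack A B x p p * slack A B x q q := hminor.le
        _ = slack A B x q q * slack A B x p p := mul_comm _ _
        _ ≤ (C * leadingVar hk (i₁ + 1) x) * (leadingVar hk i₀ x + C * leadingVar hk i₁ x) :=
          mul_le_mul h6 h1 hppos.le (by positivity))
    (by
      filter_upwards [hfeas, hSpp] with x hx h1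
      have hx' : (slack A B x).PosDef := hx
      exact (hx'.diag_pos (i := p)).le.trans h1)
    hle
  rw [hi] at hfin hi₁
  refine GrowsAt.of_rpow_le hk hi₁ (by rw [← hi]; exact hg.tendsto) hE ?_
  have hexp : 2 - ((k : ℝ) - ((i₀ + 1 : ℕ) : ℝ) - 1) / (k - ((i₀ + 1 : ℕ) : ℝ)) =
      1 + 1 / ((k : ℝ) - (i₀ + 1)) := by
    have : ((i₀ + 1 : ℕ) : ℝ) < k := by exact_mod_cast hi₁
    push_cast at this ⊢
    have : (k : ℝ) - (i₀ + 1) ≠ 0 := by linarith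
    field_simp
    ring
  rw [hexp] at hfin
  exact hfin

end Growth

/-! ### Descending induction along the strictly feasible points with the last variable tending to
infinity. -/

section Growth

open Filter Asymptotics Topology

variable {m n : ℕ}

/-- The strictly feasible completions of a tail, with `x i` tending to infinity. -/
def feasibleAtTop {k : ℕ} (A : Fin m → Matrix (Fin n) (Fin n) ℝ) (B : Matrix (Fin n) (Fin n) ℝ)
    (xbar : {i : Fin m // k ≤ (i : ℕ)} → ℝ) (i : Fin m) : Filter (Fin m → ℝ) :=
  comap (fun x => x i) atTop ⊓ 𝓟 {x | Completes xbar x ∧ StrictlyFeasible A B x}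

/-- Translates asymptotic statements into a threshold that is uniform over all strictly feasible
completions, as the theorem demands of `K`. -/
theorem eventually_feasibleAtTop {k : ℕ} {A : Fin m → Matrix (Fin n) (Fin n) ℝ}
    {B : Matrix (Fin n) (Fin n) ℝ} {xbar : {i : Fin m // k ≤ (i : ℕ)} → ℝ} {i : Fin m}
    {P : (Fin m → ℝ) → Prop} :
    (∀ᶠ x in feasibleAtTop A B xbar i, P x) ↔
      ∃ K, ∀ x, Completes xbar x → StrictlyFeasible A B x → K ≤ x i → P x := by
  rw [feasibleAtTop, eventually_inf_principal, eventually_comap, eventually_atTop]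
  constructor
  · rintro ⟨K, hK⟩
    exact ⟨K, fun x h1 h2 h3 => hK _ h3 x rfl ⟨h1, h2⟩⟩
  · rintro ⟨K, hK⟩
    exact ⟨K, fun b hb x hx h => hK x h.1 h.2 (hx ▸ hb)⟩

/-- Base of the recursion: the next variable is the constant 1 and the exponent is 0, so the power
bound reads `1 ≤ 1`. -/
theorem growsAt_last {k : ℕ} (hk : k ≤ m) {l : Filter (Fin m → ℝ)} {i : ℕ} (hi : i + 1 = k)
    (h : Tendsto (leadingVar hk i) l atTop) : GrowsAt hk l i := by
  have h1 : leadingVar hk (i + 1) = fun _ => 1 := leadingVar_of_ge hk hi.ge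
  refine ⟨h, ?_, ⟨1, one_pos, ?_⟩, fun h2 => by omega⟩
  · rw [h1, isLittleO_const_left]
    exact Or.inr (tendsto_norm_atTop_atTop.comp h)
  · have : (k : ℝ) - i - 1 = 0 := by
      rw [← hi]
      push_cast
      ring
    simp [h1, this]

theorem growsAt_feasibleAtTop {k : ℕ} (hk : k ≤ m) {s : ℕ → ℕ}
    {A : Fin m → Matrix (Fin n) (Fin n) ℝ} {B : Matrix (Fin n) (Fin n) ℝ}
    (hA : IsOffsetFRSeq k s A) (xbar : {i : Fin m // k ≤ (i : ℕ)} → ℝ)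
    (hentry : ∀ i₀ i₁ : Fin m, (i₁ : ℕ) = i₀ + 1 → (i₁ : ℕ) < k →
      ∃ p q : Fin n, s i₀ ≤ p ∧ (p : ℕ) < s i₁ ∧ s (i₁ + 1) ≤ q ∧ A i₁ p q ≠ 0)
    {last : Fin m} (hlast : (last : ℕ) + 1 = k) :
    ∀ i < k, GrowsAt hk (feasibleAtTop A B xbar last) i := by
  have key : ∀ t i, k ≤ i + 1 + t → i < k → GrowsAt hk (feasibleAtTop A B xbar last) i := by
    intro t
    induction t with
    | zero =>
      intro i h1 h2
      have hil : i = last := by omega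
      refine growsAt_last hk (by omega) (tendsto_atTop.2 fun b => ?_)
      rw [eventually_feasibleAtTop]
      refine ⟨b, fun x _ _ h => ?_⟩
      rwa [hil, leadingVar_of_lt hk last (by omega)]
    | succ t ih =>
      intro i h1 h2
      rcases Nat.lt_or_ge (i + 1) k with h3 | h3
      · refine growsAt_of_forall_gt hk (i₀ := ⟨i, by omega⟩) (i₁ := ⟨i + 1, by omega⟩) hA
          (xbar := xbar) (B := B) (eventually_feasibleAtTop.2 ⟨0, fun x hx _ _ => hx⟩)
          (eventually_feasibleAtTop.2 ⟨0, fun x _ hx _ => hx⟩) rfl h3 (hentry _ _ rfl h3) ?_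
        intro j hj hjk
        exact ih j (by simp only at hj; omega) hjk
      · exact ih i (by omega) h2
  exact fun i hi => key k i (by omega) hi

end Growth

/-- Indices in `Fin m` start at `0`: the variables `x_1, …, x_k` are the `x i` with `i < k`, and
`x_k` is the `x i` with `i + 1 = k`. For consecutive indices `i`, `j = i + 1 < k` the inequality
`x i ≥ d j * x j ^ α j` is the one between the `j`-th and the `(j + 1)`-st variable. -/
theorem theorem1 {m n : ℕ} (A : Fin m → Matrix (Fin n) (Fin n) ℝ) (B : Matrix (Fin n) (Fin n) ℝ)
    (hA : ∀ i, (A i).IsSymm) (hB : B.IsSymm)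
    (hP : ∃ x : Fin m → ℝ, StrictlyFeasible A B x)
    (k : ℕ) (A' : Fin m → Matrix (Fin n) (Fin n) ℝ) (B' : Matrix (Fin n) (Fin n) ℝ)
    (hform : IsRegularizedForm A B k A' B')
    (hmin : ∀ (k' : ℕ) (A'' : Fin m → Matrix (Fin n) (Fin n) ℝ) (B'' : Matrix (Fin n) (Fin n) ℝ),
      IsRegularizedForm A B k' A'' B'' → k ≤ k')
    (xbar : {i : Fin m // k ≤ (i : ℕ)} → ℝ)
    (hxbar : PartiallyStrictlyFeasible A' B' xbar) :
    (∀ M : ℝ, ∃ x : Fin m → ℝ, Completes xbar x ∧ StrictlyFeasible A' B' x ∧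
      ∀ i : Fin m, (i : ℕ) + 1 = k → M ≤ x i) ∧
    ∃ d α : Fin m → ℝ,
      (∀ j : Fin m, 0 < (j : ℕ) → (j : ℕ) < k →
        0 < d j ∧ α j ≤ 2 ∧ 1 + 1 / ((k : ℝ) - ((j : ℕ) : ℝ)) ≤ α j) ∧
      ∃ K : ℝ, ∀ x : Fin m → ℝ, Completes xbar x → StrictlyFeasible A' B' x →
        (∀ i : Fin m, (i : ℕ) + 1 = k → K ≤ x i) →
        (∀ i : Fin m, (i : ℕ) < k → 0 < x i) ∧
        ∀ i j : Fin m, (j : ℕ) = (i : ℕ) + 1 → (j : ℕ) < k → d j * x j ^ α j ≤ x i := by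
  obtain ⟨href, hk, r, hreg, hgr⟩ := hform
  obtain ⟨s, hs, hsk⟩ := hreg.exists_offsets
  have hn : s k ≤ n := hsk.trans_le hreg.1
  rw [← hsk] at hgr
  refine ⟨fun M => exists_strictlyFeasible_large hs hk hxbar M, ?_⟩
  rcases Nat.eq_zero_or_pos k with rfl | hkpos
  · exact ⟨0, 0, fun j _ h => absurd h (Nat.not_lt_zero _), 0, fun x _ _ _ =>
      ⟨fun i h => absurd h (Nat.not_lt_zero _), fun i j _ h => absurd h (Nat.not_lt_zero _)⟩⟩
  let last : Fin m := ⟨k - 1, by omega⟩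
  have hlast : (last : ℕ) + 1 = k := by simp only [last]; omega
  have hgrow := growsAt_feasibleAtTop (B := B') hk hs xbar
    (fun i₀ i₁ hi hi₁ => exists_entry_ne_zero_of_minimal href hs hk hn hgr hmin hi hi₁) hlast
  -- Indices outside the range get the dummy value 1, so that the constants form a total function of
  -- `j`.
  have hE : ∀ j : Fin m, ∃ E : ℝ, 0 < E ∧ (0 < (j : ℕ) → (j : ℕ) < k →
      ∀ᶠ x in feasibleAtTop A' B' xbar last,
        leadingVar hk j x ^ (1 + 1 / ((k : ℝ) - ((j : ℕ) : ℝ))) ≤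
          E * leadingVar hk ((j : ℕ) - 1) x) := by
    intro j
    by_cases hj : 0 < (j : ℕ) ∧ (j : ℕ) < k
    · obtain ⟨E, hE, h⟩ := (hgrow (j - 1) (by omega)).exists_rpow_le (by omega)
      refine ⟨E, hE, fun _ _ => ?_⟩
      have e : (j : ℕ) - 1 + 1 = j := by omega
      have e' : (((j : ℕ) - 1 : ℕ) : ℝ) + 1 = (j : ℕ) := by exact_mod_cast e
      rw [e, e'] at h
      exact h
    · exact ⟨1, one_pos, fun h1 h2 => absurd ⟨h1, h2⟩ hj⟩
  choose E hEpos hE using hE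
  have hev : ∀ᶠ x in feasibleAtTop A' B' xbar last,
      (∀ i : Fin m, (i : ℕ) < k → 0 < leadingVar hk i x) ∧
      ∀ j : Fin m, 0 < (j : ℕ) → (j : ℕ) < k →
        leadingVar hk j x ^ (1 + 1 / ((k : ℝ) - ((j : ℕ) : ℝ))) ≤
          E j * leadingVar hk ((j : ℕ) - 1) x := by
    refine Filter.Eventually.and ?_ ?_
    · refine Filter.eventually_all.2 fun i => ?_
      by_cases hi : (i : ℕ) < k
      · filter_upwards [(hgrow i hi).tendsto.eventually_gt_atTop 0] with x hx _ using hx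
      · exact Filter.Eventually.of_forall fun x h => absurd h hi
    · refine Filter.eventually_all.2 fun j => ?_
      by_cases hj : 0 < (j : ℕ) ∧ (j : ℕ) < k
      · filter_upwards [hE j hj.1 hj.2] with x hx _ _ using hx
      · exact Filter.Eventually.of_forall fun x h1 h2 => absurd ⟨h1, h2⟩ hj
  obtain ⟨K, hK⟩ := eventually_feasibleAtTop.1 hev
  -- The exponents are taken equal to their lower bounds; these are at most 2 because `k - j ≥ 1`.
  refine ⟨fun j => (E j)⁻¹, fun j => 1 + 1 / ((k : ℝ) - ((j : ℕ) : ℝ)), fun j _ hjk =>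
    ⟨inv_pos.2 (hEpos j), ?_, le_rfl⟩, K, fun x hx hxf hxK => ?_⟩
  · have : ((j : ℕ) : ℝ) + 1 ≤ k := by exact_mod_cast hjk
    have : 1 / ((k : ℝ) - ((j : ℕ) : ℝ)) ≤ 1 := by
      rw [div_le_one (by linarith)]
      linarith
    linarith
  · obtain ⟨h1, h2⟩ := hK x hx hxf (hxK last hlast)
    refine ⟨fun i hi => ?_, fun i j hij hjk => ?_⟩
    · rw [← leadingVar_of_lt hk i hi x]
      exact h1 i hi
    · have h3 := h2 j (by omega) hjk
      rw [leadingVar_of_lt hk j hjk, show (j : ℕ) - 1 = i by omega,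
        leadingVar_of_lt hk i (by omega)] at h3
      rw [inv_mul_le_iff₀ (hEpos j)]
      exact h3
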